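/- Let $n\ge 0$, $T=(\mathbb{C}^*)^n$, let $\Xi$ be a nonsingular fan in $\mathbb{R}^n$ (a nonempty, possibly infinite, collection of cones, each generated by part of a $\mathbb{Z}$-basis of $\mathbb{Z}^n$, containing all faces of its members, any two members meeting in a common face), and let $X=X_\Xi$ be the associated nonsingular toric variety, regarded as a complex manifold with its holomorphic left $T$-action. Let $G$ be a discrete group, regarded as a complex Lie group of dimension $0$. Let $\pi:\mathcal{E}\to X$ be a holomorphic $T$-equivariant principal $G$-bundle. That is: $\mathcal{E}$ is a complex manifold with a holomorphic left $T$-action and a holomorphic right $G$-action; $\pi$ is holomorphic, $\pi(te)=t\,\pi(e)$, $\pi(e\cdot g)=\pi(e)$ and $t(e\cdot g)=(te)\cdot g$ for all $t\in T$, $g\in G$, $e\in\mathcal{E}$; and every point of $X$ has an open neighbourhood $U$ with a $G$-equivariant biholomorphism $\pi^{-1}(U)\cong U\times G$ over $U$, where $G$ acts on $U\times G$ by $(x,h)\cdot g=(x,hg)$. Then $\mathcal{E}$ is trivial with trivial $T$-action: there is a $G$-equivariant biholomorphism $\Phi:\mathcal{E}\to X\times G$ over $X$, and under every such $\Phi$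 the action of $T$ on $\mathcal{E}$ corresponds to the action $t(x,h)=(tx,h)$ on $X\times G$. -/

import Mathlib

open scoped Manifold ContDiff

noncomputable section

/-! ### The algebraic torus -/

/-- The algebraic torus `T = (ℂ^*)^n`. -/
def Torus (n : ℕ) : Type := Fin n → ℂˣ

namespace Torus

variable {n : ℕ}

instance : CommGroup (Torus n) := inferInstanceAs (CommGroup (Fin n → ℂˣ))

instance : TopologicalSpace (Torus n) := inferInstanceAs (TopologicalSpace (Fin n → ℂˣ))

/-- The inclusion `(ℂ^*)^n ⊆ ℂ^n`. -/
def coords (t : Torus n) : Fin n → ℂ := fun i => (t i : ℂ)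

theorem isOpenEmbedding_coords :
    Topology.IsOpenEmbedding (coords : Torus n → (Fin n → ℂ)) :=
  Topology.IsOpenEmbedding.piMap (fun _ : Fin n => Units.isOpenEmbedding_val (R := ℂ))

/-- The complex structure of `T` is the one of an open subset of `ℂ^n`. -/
instance : ChartedSpace (Fin n → ℂ) (Torus n) :=
  isOpenEmbedding_coords.singletonChartedSpace

instance : IsManifold 𝓘(ℂ, Fin n → ℂ) ω (Torus n) :=
  isOpenEmbedding_coords.isManifold_singleton

/-- The character `χ^m : T → ℂ^*` of a lattice point `m` of `M = ℤ^n`. -/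
def character (m : Fin n → ℤ) (t : Torus n) : ℂ := ∏ i, (t i : ℂ) ^ m i

theorem character_ne_zero (m : Fin n → ℤ) (t : Torus n) : character m t ≠ 0 :=
  Finset.prod_ne_zero_iff.2 fun i _ => zpow_ne_zero _ (t i).ne_zero

theorem character_zero (t : Torus n) : character 0 t = 1 := by simp [character]

theorem character_add (m m' : Fin n → ℤ) (t : Torus n) :
    character (m + m') t = character m t * character m' t := by
  simp only [character, Pi.add_apply, ← Finset.prod_mul_distrib]
  exact Finset.prod_congr rfl fun i _ => zpow_add₀ (t i).ne_zero _ _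

theorem character_one (m : Fin n → ℤ) : character m (1 : Torus n) = 1 :=
  Finset.prod_eq_one fun i _ => by
    have : ((1 : Torus n) i) = 1 := rfl
    simp [this]

theorem character_mul (m : Fin n → ℤ) (s t : Torus n) :
    character m (s * t) = character m s * character m t := by
  simp only [character, ← Finset.prod_mul_distrib]
  refine Finset.prod_congr rfl fun i _ => ?_
  have : (s * t) i = s i * t i := rfl
  rw [this, Units.val_mul, mul_zpow]

end Torus

/-! ### Lattice cones in `N_ℝ = ℝ^n`, with `N = ℤ^n`, `M = ℤ^n` and the standard pairing -/

/-- The pairing of a point of `M = ℤ^n` with a vector of `N_ℝ = ℝ^n`. -/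
def latticePairing {n : ℕ} (m : Fin n → ℤ) (v : Fin n → ℝ) : ℝ := ∑ k, (m k : ℝ) * v k

/-- A lattice point of `N = ℤ^n` as a vector of `N_ℝ = ℝ^n`. -/
def latticeVec {n : ℕ} (w : Fin n → ℤ) : Fin n → ℝ := fun k => (w k : ℝ)

/-- The cone generated by the members `b i`, `i ∈ J`, of a `ℤ`-basis `b` of `N = ℤ^n`. -/
def basisCone {n : ℕ} (b : Module.Basis (Fin n) ℤ (Fin n → ℤ)) (J : Set (Fin n)) :
    PointedCone ℝ (Fin n → ℝ) :=
  PointedCone.hull ℝ ((fun i => latticeVec (b i)) '' J)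

/-- `m ∈ τ^⊥ ∩ M`. -/
def PerpTo {n : ℕ} (τ : PointedCone ℝ (Fin n → ℝ)) (m : Fin n → ℤ) : Prop :=
  ∀ v ∈ τ, latticePairing m v = 0

/-- The members of the basis of `M = ℤ^n` dual to a `ℤ`-basis `b` of `N = ℤ^n`. -/
def dualVec {n : ℕ} (b : Module.Basis (Fin n) ℤ (Fin n → ℤ)) (i : Fin n) : Fin n → ℤ :=
  fun k => b.repr (Pi.single k 1) i

/-- A nonsingular fan in `N_ℝ = ℝ^n`: a nonempty collection of cones, each generated by a part of a
`ℤ`-basis of `N = ℤ^n` (in particular rational polyhedral and strongly convex), which contains every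
face of each of its members and in which any two members intersect in a common face. The collection
may be infinite. -/
structure NonsingularFan (n : ℕ) where
  cones : Set (PointedCone ℝ (Fin n → ℝ))
  nonempty : cones.Nonempty
  nonsingular : ∀ σ ∈ cones, ∃ (b : Module.Basis (Fin n) ℤ (Fin n → ℤ)) (J : Set (Fin n)),
    σ = basisCone b J
  face_mem : ∀ σ ∈ cones, ∀ τ : PointedCone ℝ (Fin n → ℝ), τ.IsFaceOf σ → τ ∈ cones
  inter_face : ∀ σ ∈ cones, ∀ τ ∈ cones, (σ ⊓ τ).IsFaceOf σ ∧ (σ ⊓ τ).IsFaceOf τ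

section LatticeLemmas

variable {n : ℕ} (b : Module.Basis (Fin n) ℤ (Fin n → ℤ))

theorem latticePairing_latticeVec (m w : Fin n → ℤ) :
    latticePairing m (latticeVec w) = ((m ⬝ᵥ w : ℤ) : ℝ) := by
  simp [latticePairing, latticeVec, dotProduct]

theorem latticePairing_add_left (m m' : Fin n → ℤ) (v : Fin n → ℝ) :
    latticePairing (m + m') v = latticePairing m v + latticePairing m' v := by
  simp [latticePairing, add_mul, Finset.sum_add_distrib]

theorem latticePairing_neg_left (m : Fin n → ℤ) (v : Fin n → ℝ) :
    latticePairing (-m) v = - latticePairing m v := by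
  simp [latticePairing]

theorem latticePairing_zero_left (v : Fin n → ℝ) : latticePairing 0 v = 0 := by
  simp [latticePairing]

theorem latticePairing_add_right (m : Fin n → ℤ) (v w : Fin n → ℝ) :
    latticePairing m (v + w) = latticePairing m v + latticePairing m w := by
  simp [latticePairing, mul_add, Finset.sum_add_distrib]

theorem latticePairing_smul_right (m : Fin n → ℤ) (a : ℝ) (v : Fin n → ℝ) :
    latticePairing m (a • v) = a * latticePairing m v := by
  simp only [latticePairing, Pi.smul_apply, smul_eq_mul, Finset.mul_sum]
  exact Finset.sum_congr rfl fun k _ => by ring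

theorem dualVec_dotProduct (i : Fin n) (w : Fin n → ℤ) : dualVec b i ⬝ᵥ w = b.repr w i := by
  have h : w = ∑ k, w k • (Pi.single k 1 : Fin n → ℤ) := by
    simpa using pi_eq_sum_univ' w
  conv_rhs => rw [h]
  rw [map_sum, Finsupp.finsetSum_apply]
  refine Finset.sum_congr rfl fun k _ => ?_
  rw [map_smul, Finsupp.smul_apply, smul_eq_mul, mul_comm]
  rfl

theorem dualVec_dotProduct_basis (i j : Fin n) :
    dualVec b i ⬝ᵥ b j = if i = j then 1 else 0 := by
  rw [dualVec_dotProduct, Module.Basis.repr_self, Finsupp.single_apply]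
  simp [eq_comm]

theorem sum_dualVec_mul (k l : Fin n) :
    ∑ i, dualVec b i k * b i l = if k = l then 1 else 0 := by
  have h := congrFun (b.sum_repr (Pi.single k 1)) l
  simp only [Finset.sum_apply, Pi.smul_apply, smul_eq_mul, Pi.single_apply] at h
  rw [show (if k = l then (1 : ℤ) else 0) = if l = k then 1 else 0 by simp [eq_comm], ← h]
  rfl

theorem eq_sum_dualVec (m : Fin n → ℤ) : m = ∑ i, (m ⬝ᵥ b i) • dualVec b i := by
  ext k
  simp only [Finset.sum_apply, Pi.smul_apply, smul_eq_mul, dotProduct, Finset.sum_mul]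
  rw [Finset.sum_comm]
  have : ∀ l, ∑ i, m l * b i l * dualVec b i k = m l * if k = l then 1 else 0 := by
    intro l
    rw [← sum_dualVec_mul b k l, Finset.mul_sum]
    exact Finset.sum_congr rfl fun i _ => by ring
  simp [this]

theorem eq_sum_latticeVec (v : Fin n → ℝ) :
    v = ∑ i, latticePairing (dualVec b i) v • latticeVec (b i) := by
  ext l
  simp only [Finset.sum_apply, Pi.smul_apply, smul_eq_mul, latticePairing, latticeVec,
    Finset.sum_mul]
  rw [Finset.sum_comm]
  have : ∀ k, ∑ i, (dualVec b i k : ℝ) * v k * (b i l : ℝ) = v k * if k = l then 1 else 0 := by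
    intro k
    have h : ((∑ i, dualVec b i k * b i l : ℤ) : ℝ) = if k = l then 1 else 0 := by
      rw [sum_dualVec_mul]; split_ifs <;> simp
    rw [← h, Int.cast_sum, Finset.mul_sum]
    exact Finset.sum_congr rfl fun i _ => by push_cast; ring
  simp [this]

theorem latticePairing_dualVec_latticeVec (i j : Fin n) :
    latticePairing (dualVec b i) (latticeVec (b j)) = if i = j then 1 else 0 := by
  rw [latticePairing_latticeVec, dualVec_dotProduct_basis]
  split_ifs <;> simp

theorem latticeVec_mem_basisCone {J : Set (Fin n)} {i : Fin n} (hi : i ∈ J) :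
    latticeVec (b i) ∈ basisCone b J :=
  PointedCone.subset_hull ⟨i, hi, rfl⟩

theorem mem_basisCone_iff (J : Set (Fin n)) (v : Fin n → ℝ) :
    v ∈ basisCone b J ↔
      ∀ i, 0 ≤ latticePairing (dualVec b i) v ∧ (i ∉ J → latticePairing (dualVec b i) v = 0) := by
  constructor
  · intro hv
    refine Submodule.span_induction ?_ ?_ ?_ ?_ hv
    · rintro _ ⟨j, hj, rfl⟩ i
      simp only [latticePairing_dualVec_latticeVec]
      refine ⟨by split_ifs <;> norm_num, fun hi => if_neg ?_⟩
      rintro rfl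
      exact hi hj
    · intro i
      simp [latticePairing]
    · intro x y _ _ hx hy i
      rw [latticePairing_add_right]
      exact ⟨add_nonneg (hx i).1 (hy i).1, fun hi => by rw [(hx i).2 hi, (hy i).2 hi, add_zero]⟩
    · intro a x _ hx i
      change 0 ≤ latticePairing _ ((a : ℝ) • x) ∧ (_ → latticePairing _ ((a : ℝ) • x) = 0)
      rw [latticePairing_smul_right]
      exact ⟨mul_nonneg a.2 (hx i).1, fun hi => by rw [(hx i).2 hi, mul_zero]⟩
  · intro h
    rw [eq_sum_latticeVec b v]
    refine Submodule.sum_mem _ fun i _ => ?_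
    by_cases hi : i ∈ J
    · exact PointedCone.smul_mem _ (h i).1 (latticeVec_mem_basisCone b hi)
    · rw [(h i).2 hi, zero_smul]
      exact Submodule.zero_mem _

theorem latticeVec_mem_basisCone_iff (J : Set (Fin n)) (i : Fin n) :
    latticeVec (b i) ∈ basisCone b J ↔ i ∈ J := by
  refine ⟨fun h => ?_, latticeVec_mem_basisCone b⟩
  by_contra hi
  have := ((mem_basisCone_iff b J _).1 h i).2 hi
  simp [latticePairing_dualVec_latticeVec] at this

theorem basisCone_mono {K J : Set (Fin n)} (h : K ⊆ J) : basisCone b K ≤ basisCone b J :=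
  Submodule.span_mono (Set.image_mono h)

theorem basisCone_isFaceOf {K J : Set (Fin n)} (h : K ⊆ J) :
    (basisCone b K).IsFaceOf (basisCone b J) where
  le := basisCone_mono b h
  mem_of_smul_add_mem := by
    intro x y a hx hy ha hxy
    rw [mem_basisCone_iff] at hx hy hxy ⊢
    refine fun i => ⟨(hx i).1, fun hi => ?_⟩
    have h1 := (hxy i).2 hi
    rw [latticePairing_add_right, latticePairing_smul_right] at h1
    have h2 := mul_nonneg ha.le (hx i).1
    have h3 := (hy i).1
    have h4 : a * latticePairing (dualVec b i) x = 0 := by linarith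
    exact (mul_eq_zero.1 h4).resolve_left ha.ne'

theorem eq_basisCone_of_isFaceOf {τ : PointedCone ℝ (Fin n → ℝ)} {J : Set (Fin n)}
    (h : τ.IsFaceOf (basisCone b J)) :
    τ = basisCone b {j | j ∈ J ∧ latticeVec (b j) ∈ τ} := by
  apply le_antisymm
  · intro v hv
    have hv' := (mem_basisCone_iff b J v).1 (h.le hv)
    rw [mem_basisCone_iff]
    refine fun i => ⟨(hv' i).1, fun hi => ?_⟩
    by_contra hne
    have hiJ : i ∈ J := by
      by_contra hiJ
      exact hne ((hv' i).2 hiJ)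
    refine hi ⟨hiJ, ?_⟩
    have hs := hv
    rw [eq_sum_latticeVec b v, ← Finset.add_sum_erase _ _ (Finset.mem_univ i)] at hs
    refine h.mem_of_smul_add_mem (latticeVec_mem_basisCone b hiJ) ?_
      (lt_of_le_of_ne (hv' i).1 (Ne.symm hne)) hs
    refine Submodule.sum_mem _ fun j _ => ?_
    by_cases hj : j ∈ J
    · exact PointedCone.smul_mem _ (hv' j).1 (latticeVec_mem_basisCone b hj)
    · rw [(hv' j).2 hj, zero_smul]
      exact Submodule.zero_mem _
  · refine Submodule.span_le.2 ?_
    rintro _ ⟨j, hj, rfl⟩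
    exact hj.2

theorem perpTo_basisCone_iff (K : Set (Fin n)) (m : Fin n → ℤ) :
    PerpTo (basisCone b K) m ↔ ∀ i ∈ K, m ⬝ᵥ b i = 0 := by
  constructor
  · intro h i hi
    have := h _ (latticeVec_mem_basisCone b hi)
    rw [latticePairing_latticeVec] at this
    exact_mod_cast this
  · intro h v hv
    refine Submodule.span_induction ?_ ?_ ?_ ?_ hv
    · rintro _ ⟨j, hj, rfl⟩
      simp [latticePairing_latticeVec, h j hj]
    · simp [latticePairing]
    · intro x y _ _ hx hy
      rw [latticePairing_add_right, hx, hy, add_zero]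
    · intro a x _ hx
      change latticePairing _ ((a : ℝ) • x) = 0
      rw [latticePairing_smul_right, hx, mul_zero]

theorem perpTo_dualVec_iff (K : Set (Fin n)) (i : Fin n) :
    PerpTo (basisCone b K) (dualVec b i) ↔ i ∉ K := by
  rw [perpTo_basisCone_iff]
  constructor
  · intro h hi
    have := h i hi
    simp [dualVec_dotProduct_basis] at this
  · intro hi j hj
    rw [dualVec_dotProduct_basis, if_neg]
    rintro rfl
    exact hi hj

theorem PerpTo.zero (τ : PointedCone ℝ (Fin n → ℝ)) : PerpTo τ 0 :=
  fun _ _ => latticePairing_zero_left _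

theorem PerpTo.add {τ : PointedCone ℝ (Fin n → ℝ)} {m m' : Fin n → ℤ} (h : PerpTo τ m)
    (h' : PerpTo τ m') : PerpTo τ (m + m') :=
  fun v hv => by rw [latticePairing_add_left, h v hv, h' v hv, add_zero]

theorem PerpTo.neg {τ : PointedCone ℝ (Fin n → ℝ)} {m : Fin n → ℤ} (h : PerpTo τ m) :
    PerpTo τ (-m) :=
  fun v hv => by rw [latticePairing_neg_left, h v hv, neg_zero]

theorem PerpTo.nsmul {τ : PointedCone ℝ (Fin n → ℝ)} {m : Fin n → ℤ} (h : PerpTo τ m) (k : ℕ) :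
    PerpTo τ (k • m) := by
  induction k with
  | zero => simpa using PerpTo.zero τ
  | succ k ih => rw [succ_nsmul]; exact ih.add h

theorem PerpTo.zsmul {τ : PointedCone ℝ (Fin n → ℝ)} {m : Fin n → ℤ} (h : PerpTo τ m) (k : ℤ) :
    PerpTo τ (k • m) := by
  obtain ⟨j, rfl | rfl⟩ := k.eq_nat_or_neg
  · simpa using h.nsmul j
  · simpa using (h.nsmul j).neg

end LatticeLemmas

/-! ### The toric variety of a nonsingular fan -/

/-- The points of the toric variety `X_Ξ`. It is the disjoint union of its torus orbits `O_τ`,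
`τ ∈ Ξ`, and `O_τ` is the group of homomorphisms `τ^⊥ ∩ M → ℂ^*`. A point of `O_τ` is recorded as the
function on `M` which is the homomorphism on `τ^⊥ ∩ M` and zero elsewhere. Restricted to
`σ^∨ ∩ M` for a cone `σ ∈ Ξ` of which `τ` is a face, this function is the corresponding point
`σ^∨ ∩ M → ℂ` (a homomorphism of monoids) of the affine toric variety `X_σ`. -/
@[ext]
structure ToricVariety {n : ℕ} (Ξ : NonsingularFan n) where
  cone : PointedCone ℝ (Fin n → ℝ)
  cone_mem : cone ∈ Ξ.cones
  val : (Fin n → ℤ) → ℂ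
  val_ne_zero_iff : ∀ m, val m ≠ 0 ↔ PerpTo cone m
  val_zero : val 0 = 1
  val_add : ∀ m m', PerpTo cone m → PerpTo cone m' → val (m + m') = val m * val m'

namespace ToricVariety

variable {n : ℕ} {Ξ : NonsingularFan n}

/-- The torus acts by `(t • x)(m) = χ^m(t) x(m)`. -/
instance : MulAction (Torus n) (ToricVariety Ξ) where
  smul t x :=
    { cone := x.cone
      cone_mem := x.cone_mem
      val := fun m => Torus.character m t * x.val m
      val_ne_zero_iff := fun m => by
        rw [← x.val_ne_zero_iff m, mul_ne_zero_iff]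
        exact and_iff_right (Torus.character_ne_zero m t)
      val_zero := by rw [Torus.character_zero, x.val_zero, one_mul]
      val_add := fun m m' h h' => by
        rw [Torus.character_add, x.val_add m m' h h']
        ring }
  one_smul x := ToricVariety.ext rfl (funext fun m => by
    change Torus.character m 1 * x.val m = x.val m
    rw [Torus.character_one, one_mul])
  mul_smul s t x := ToricVariety.ext rfl (funext fun m => by
    change Torus.character m (s * t) * x.val m
      = Torus.character m s * (Torus.character m t * x.val m)
    rw [Torus.character_mul, mul_assoc])

theorem val_nsmul (x : ToricVariety Ξ) {m : Fin n → ℤ} (h : PerpTo x.cone m) (k : ℕ) :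
    x.val (k • m) = x.val m ^ k := by
  induction k with
  | zero => simp [x.val_zero]
  | succ k ih => rw [succ_nsmul, x.val_add _ _ (h.nsmul k) h, ih, pow_succ]

theorem val_neg (x : ToricVariety Ξ) {m : Fin n → ℤ} (h : PerpTo x.cone m) :
    x.val (-m) = (x.val m)⁻¹ := by
  have := x.val_add m (-m) h h.neg
  rw [add_neg_cancel, x.val_zero] at this
  exact eq_inv_of_mul_eq_one_right this.symm

theorem val_zsmul (x : ToricVariety Ξ) {m : Fin n → ℤ} (h : PerpTo x.cone m) (k : ℤ) :
    x.val (k • m) = x.val m ^ k := by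
  obtain ⟨j, rfl | rfl⟩ := k.eq_nat_or_neg
  · simpa using x.val_nsmul h j
  · rw [neg_smul, val_neg x (h.zsmul _), zpow_neg, natCast_zsmul, val_nsmul x h, zpow_natCast]

theorem val_sum (x : ToricVariety Ξ) {ι : Type*} (s : Finset ι) (f : ι → Fin n → ℤ)
    (h : ∀ i ∈ s, PerpTo x.cone (f i)) :
    PerpTo x.cone (∑ i ∈ s, f i) ∧ x.val (∑ i ∈ s, f i) = ∏ i ∈ s, x.val (f i) := by
  classical
  induction s using Finset.induction_on with
  | empty => simpa using ⟨PerpTo.zero _, x.val_zero⟩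
  | insert a s ha ih =>
    obtain ⟨h1, h2⟩ := ih fun i hi => h i (Finset.mem_insert_of_mem hi)
    have h3 := h a (Finset.mem_insert_self a s)
    rw [Finset.sum_insert ha, Finset.prod_insert ha]
    exact ⟨h3.add h1, by rw [x.val_add _ _ h3 h1, h2]⟩

/-- The monomial function with the exponents `a`, with `0 ^ a i` replaced by `1`. -/
def unitMonomial (z : Fin n → ℂ) (a : Fin n → ℤ) : ℂ :=
  open Classical in ∏ i, (if z i = 0 then 1 else z i) ^ a i

theorem unitMonomial_ne_zero (z : Fin n → ℂ) (a : Fin n → ℤ) : unitMonomial z a ≠ 0 := by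
  refine Finset.prod_ne_zero_iff.2 fun i _ => zpow_ne_zero _ ?_
  split_ifs with h
  · exact one_ne_zero
  · exact h

variable (b : Module.Basis (Fin n) ℤ (Fin n → ℤ)) (J : Set (Fin n))

/-- The point of `X_σ`, where `σ` is the cone generated by the `b i`, `i ∈ J`, at which the
coordinates (the values at the dual basis) are `z`. It lies in the orbit of the face generated by
the `b i` with `i ∈ J` and `z i = 0`. -/
def ofCoords (hσ : basisCone b J ∈ Ξ.cones) (z : Fin n → ℂ) : ToricVariety Ξ where
  cone := basisCone b {i | i ∈ J ∧ z i = 0}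
  cone_mem := Ξ.face_mem _ hσ _ (basisCone_isFaceOf b fun _ hi => hi.1)
  val := fun m => open Classical in
    if PerpTo (basisCone b {i | i ∈ J ∧ z i = 0}) m then unitMonomial z (fun i => m ⬝ᵥ b i) else 0
  val_ne_zero_iff := fun m => by
    split_ifs with h
    · exact iff_of_true (unitMonomial_ne_zero _ _) h
    · exact iff_of_false (fun h' => h' rfl) h
  val_zero := by
    rw [if_pos (PerpTo.zero _)]
    simp [unitMonomial]
  val_add := fun m m' h h' => by
    rw [if_pos h, if_pos h', if_pos (h.add h')]
    simp only [unitMonomial, ← Finset.prod_mul_distrib]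
    refine Finset.prod_congr rfl fun i _ => ?_
    rw [add_dotProduct, zpow_add₀]
    split_ifs with hz
    · exact one_ne_zero
    · exact hz

/-- The chart of `X_Ξ` with domain `X_σ`, where `σ` is the cone generated by the `b i`, `i ∈ J`. It
evaluates a point at the basis of `M` dual to `b`, and so identifies `X_σ` with the set of the
`z ∈ ℂ^n` such that `z i ≠ 0` for `i ∉ J`, that is, with `ℂ^d × (ℂ^*)^(n-d)` for `d = dim σ`. -/
def affineChart (hσ : basisCone b J ∈ Ξ.cones) : PartialEquiv (ToricVariety Ξ) (Fin n → ℂ) where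
  toFun x := fun i => x.val (dualVec b i)
  invFun := ofCoords b J hσ
  source := {x | x.cone.IsFaceOf (basisCone b J)}
  target := {z | ∀ i, i ∉ J → z i ≠ 0}
  map_source' := by
    intro x hx i hi
    rw [x.val_ne_zero_iff, eq_basisCone_of_isFaceOf b hx, perpTo_dualVec_iff]
    exact fun h => hi h.1
  map_target' := fun z _ => basisCone_isFaceOf b fun _ hi => hi.1
  left_inv' := by
    intro x hx
    have hc := eq_basisCone_of_isFaceOf b hx
    have hz : ∀ i, x.val (dualVec b i) = 0 ↔ i ∈ J ∧ latticeVec (b i) ∈ x.cone := by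
      intro i
      have h1 := x.val_ne_zero_iff (dualVec b i)
      have h2 := perpTo_dualVec_iff b {j | j ∈ J ∧ latticeVec (b j) ∈ x.cone} i
      rw [← hc] at h2
      rw [← not_iff_not]
      exact h1.trans h2
    have hset : {i | i ∈ J ∧ x.val (dualVec b i) = 0}
        = {j | j ∈ J ∧ latticeVec (b j) ∈ x.cone} := by
      ext i
      simp only [Set.mem_ofPred_eq, hz]
      tauto
    have hcone : basisCone b {i | i ∈ J ∧ x.val (dualVec b i) = 0} = x.cone := by
      rw [hset, ← hc]
    refine ToricVariety.ext hcone (funext fun m => ?_)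
    change (open Classical in if PerpTo (basisCone b {i | i ∈ J ∧ x.val (dualVec b i) = 0}) m
      then unitMonomial (fun i => x.val (dualVec b i)) (fun i => m ⬝ᵥ b i) else 0) = x.val m
    rw [hcone]
    split_ifs with hm
    · have hm' : ∀ i, x.val (dualVec b i) = 0 → m ⬝ᵥ b i = 0 := by
        intro i hi
        have := hm
        rw [hc, perpTo_basisCone_iff] at this
        exact this i ((hz i).1 hi)
      have hp : ∀ i, PerpTo x.cone ((m ⬝ᵥ b i) • dualVec b i) := by
        intro i
        by_cases hi : x.val (dualVec b i) = 0
        · rw [hm' i hi, zero_smul]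
          exact PerpTo.zero _
        · exact ((x.val_ne_zero_iff _).1 hi).zsmul _
      conv_rhs => rw [eq_sum_dualVec b m]
      rw [(x.val_sum Finset.univ _ fun i _ => hp i).2]
      refine Finset.prod_congr rfl fun i _ => ?_
      by_cases hi : x.val (dualVec b i) = 0
      · change _ ^ (m ⬝ᵥ b i) = _
        rw [hm' i hi, zero_smul, x.val_zero, zpow_zero]
      · rw [if_neg hi, x.val_zsmul ((x.val_ne_zero_iff _).1 hi)]
    · by_contra h
      exact hm ((x.val_ne_zero_iff m).1 (Ne.symm h))
  right_inv' := by
    intro z hz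
    ext i
    change (open Classical in if PerpTo (basisCone b {i | i ∈ J ∧ z i = 0}) (dualVec b i)
      then unitMonomial z (fun j => dualVec b i ⬝ᵥ b j) else 0) = z i
    have hp := perpTo_dualVec_iff b {i | i ∈ J ∧ z i = 0} i
    by_cases hzi : z i ≠ 0
    · rw [if_pos (hp.2 fun h => hzi h.2)]
      unfold unitMonomial
      rw [Finset.prod_eq_single i]
      · rw [if_neg hzi]
        change z i ^ (dualVec b i ⬝ᵥ b i) = _
        rw [dualVec_dotProduct_basis, if_pos rfl, zpow_one]
      · intro j _ hj
        change _ ^ (dualVec b i ⬝ᵥ b j) = _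
        rw [dualVec_dotProduct_basis, if_neg (Ne.symm hj), zpow_zero]
      · intro h'
        exact absurd (Finset.mem_univ i) h'
    · have hi : i ∈ J := by
        by_contra hi
        exact hzi (hz i hi)
      rw [if_neg fun h => hp.1 h ⟨hi, not_not.1 hzi⟩]
      exact (not_not.1 hzi).symm

variable {b J}

/-- The domain of a coordinate change is cut out by the non-vanishing of some coordinates. -/
theorem mem_transition_source_iff {b' : Module.Basis (Fin n) ℤ (Fin n → ℤ)} {J' : Set (Fin n)}
    (hσ : basisCone b J ∈ Ξ.cones) (hσ' : basisCone b' J' ∈ Ξ.cones) (z : Fin n → ℂ) :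
    z ∈ ((affineChart b J hσ).symm.trans (affineChart b' J' hσ')).source ↔
      ∀ i, z i = 0 → i ∈ J ∧ latticeVec (b i) ∈ basisCone b' J' := by
  rw [PartialEquiv.trans_source]
  change ((∀ i, i ∉ J → z i ≠ 0) ∧
    (basisCone b {i | i ∈ J ∧ z i = 0}).IsFaceOf (basisCone b' J')) ↔ _
  constructor
  · rintro ⟨h1, h2⟩ i hi
    have hiJ : i ∈ J := by
      by_contra h
      exact h1 i h hi
    exact ⟨hiJ, h2.le (latticeVec_mem_basisCone b ⟨hiJ, hi⟩)⟩
  · intro h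
    refine ⟨fun i hi h0 => hi (h i h0).1, ?_⟩
    obtain ⟨f1, f2⟩ := Ξ.inter_face _ hσ _ hσ'
    refine PointedCone.IsFaceOf.trans ?_ f2
    rw [eq_basisCone_of_isFaceOf b f1]
    refine basisCone_isFaceOf b fun i hi => ⟨hi.1, ?_⟩
    exact Submodule.mem_inf.2 ⟨latticeVec_mem_basisCone b hi.1, (h i hi.2).2⟩

/-- A coordinate change is given by Laurent monomials. -/
theorem transition_apply {b' : Module.Basis (Fin n) ℤ (Fin n → ℤ)} {J' : Set (Fin n)}
    (hσ : basisCone b J ∈ Ξ.cones) (hσ' : basisCone b' J' ∈ Ξ.cones) {z : Fin n → ℂ}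
    (hz : z ∈ ((affineChart b J hσ).symm.trans (affineChart b' J' hσ')).source) (k : Fin n) :
    ((affineChart b J hσ).symm.trans (affineChart b' J' hσ')) z k
      = ∏ i, z i ^ (dualVec b' k ⬝ᵥ b i) := by
  rw [mem_transition_source_iff] at hz
  change (open Classical in if PerpTo (basisCone b {i | i ∈ J ∧ z i = 0}) (dualVec b' k)
      then unitMonomial z (fun j => dualVec b' k ⬝ᵥ b j) else 0) = _
  split_ifs with h
  · rw [perpTo_basisCone_iff] at h
    refine Finset.prod_congr rfl fun i _ => ?_
    split_ifs with hi
    · change 1 ^ (dualVec b' k ⬝ᵥ b i) = _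
      rw [h i ⟨(hz i hi).1, hi⟩, zpow_zero, zpow_zero]
    · rfl
  · rw [perpTo_basisCone_iff] at h
    push Not at h
    obtain ⟨i, ⟨_, hi⟩, hne⟩ := h
    exact (Finset.prod_eq_zero (Finset.mem_univ i) (by rw [hi, zero_zpow _ hne])).symm

theorem isOpen_transition_source {b' : Module.Basis (Fin n) ℤ (Fin n → ℤ)} {J' : Set (Fin n)}
    (hσ : basisCone b J ∈ Ξ.cones) (hσ' : basisCone b' J' ∈ Ξ.cones) :
    IsOpen ((affineChart b J hσ).symm.trans (affineChart b' J' hσ')).source := by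
  have : ((affineChart b J hσ).symm.trans (affineChart b' J' hσ')).source
      = ⋂ i : Fin n, {z | ¬ (i ∈ J ∧ latticeVec (b i) ∈ basisCone b' J') → z i ≠ 0} := by
    ext z
    rw [mem_transition_source_iff]
    simp only [Set.mem_iInter, Set.mem_ofPred_eq]
    exact forall_congr' fun i => by tauto
  rw [this]
  refine isOpen_iInter_of_finite fun i => ?_
  by_cases h : i ∈ J ∧ latticeVec (b i) ∈ basisCone b' J'
  · simp [h]
  · simpa only [h, not_false_eq_true, forall_true_left] using
      isOpen_ne_fun (continuous_apply i) continuous_const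

theorem contDiffOn_transition {b' : Module.Basis (Fin n) ℤ (Fin n → ℤ)} {J' : Set (Fin n)}
    (hσ : basisCone b J ∈ Ξ.cones) (hσ' : basisCone b' J' ∈ Ξ.cones) :
    ContDiffOn ℂ ω ((affineChart b J hσ).symm.trans (affineChart b' J' hσ'))
      ((affineChart b J hσ).symm.trans (affineChart b' J' hσ')).source := by
  have key : ContDiffOn ℂ ω (fun z : Fin n → ℂ => fun k => ∏ i, z i ^ (dualVec b' k ⬝ᵥ b i))
      ((affineChart b J hσ).symm.trans (affineChart b' J' hσ')).source := by
    intro z hz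
    rw [mem_transition_source_iff] at hz
    refine ContDiffAt.contDiffWithinAt (contDiffAt_pi.2 fun k => ?_)
    refine contDiffAt_prod fun i _ => ?_
    have hpr : AnalyticAt ℂ (fun w : Fin n → ℂ => w i) z :=
      (ContinuousLinearMap.proj (R := ℂ) (φ := fun _ : Fin n => ℂ) i).analyticAt z
    by_cases hi : z i = 0
    · have h0 : 0 ≤ dualVec b' k ⬝ᵥ b i := by
        have := ((mem_basisCone_iff b' J' _).1 (hz i hi).2 k).1
        rw [latticePairing_latticeVec] at this
        exact_mod_cast this
      exact (hpr.fun_zpow_nonneg h0).contDiffAt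
    · exact (hpr.fun_zpow hi).contDiffAt
  exact key.congr fun z hz => funext fun k => transition_apply hσ hσ' hz k

variable (Ξ) in
/-- The atlas of `X_Ξ`: one chart for each `ℤ`-basis `b` of `N` and each `J` such that the cone
generated by the `b i`, `i ∈ J`, belongs to the fan. -/
def chartCore : ChartedSpaceCore (Fin n → ℂ) (ToricVariety Ξ) where
  atlas := {e | ∃ (b : Module.Basis (Fin n) ℤ (Fin n → ℤ)) (J : Set (Fin n))
    (hσ : basisCone b J ∈ Ξ.cones), e = affineChart b J hσ}
  chartAt x :=
    affineChart (Ξ.nonsingular _ x.cone_mem).choose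
      (Ξ.nonsingular _ x.cone_mem).choose_spec.choose
      ((Ξ.nonsingular _ x.cone_mem).choose_spec.choose_spec ▸ x.cone_mem)
  mem_chart_source x := by
    change x.cone.IsFaceOf _
    rw [← (Ξ.nonsingular _ x.cone_mem).choose_spec.choose_spec]
  chart_mem_atlas x := ⟨_, _, _, rfl⟩
  open_source := by
    rintro _ _ ⟨b, J, hσ, rfl⟩ ⟨b', J', hσ', rfl⟩
    exact isOpen_transition_source hσ hσ'
  continuousOn_toFun := by
    rintro _ _ ⟨b, J, hσ, rfl⟩ ⟨b', J', hσ', rfl⟩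
    exact (contDiffOn_transition hσ hσ').continuousOn

instance : TopologicalSpace (ToricVariety Ξ) := (chartCore Ξ).toTopologicalSpace

instance : ChartedSpace (Fin n → ℂ) (ToricVariety Ξ) := (chartCore Ξ).toChartedSpace

/-- `X_Ξ` is a complex manifold of dimension `n`. -/
instance : IsManifold 𝓘(ℂ, Fin n → ℂ) ω (ToricVariety Ξ) := by
  refine isManifold_of_contDiffOn _ _ _ ?_
  intro e e' he he'
  obtain ⟨_, ⟨e₀, rfl⟩, _, ⟨⟨b, J, hσ, rfl⟩, rfl⟩, rfl⟩ := he
  obtain ⟨_, ⟨e₁, rfl⟩, _, ⟨⟨b', J', hσ', rfl⟩, rfl⟩, rfl⟩ := he'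
  simp only [modelWithCornersSelf_coe, modelWithCornersSelf_coe_symm, Set.range_id, Set.inter_univ,
    Set.preimage_id, Function.comp_id, Function.id_comp]
  exact contDiffOn_transition hσ hσ'

end ToricVariety

/-! ### Holomorphic equivariant principal bundles -/

/-- A discrete group as a complex manifold of dimension zero. -/
instance discreteChartedSpace {G : Type*} [TopologicalSpace G] [DiscreteTopology G] :
    ChartedSpace (Fin 0 → ℂ) G :=
  ChartedSpace.ofDiscreteTopology

/-- A discrete group is a complex Lie group of dimension zero. -/
instance discreteLieGroup {G : Type*} [Group G] [TopologicalSpace G] [DiscreteTopology G] :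
    LieGroup 𝓘(ℂ, Fin 0 → ℂ) ω G where
  toIsManifold := IsManifold.of_discreteTopology ω
  contMDiff_mul := contMDiff_of_discreteTopology
  contMDiff_inv := contMDiff_of_discreteTopology

section Bundles

variable {n : ℕ}
  {A : Type*} [NormedAddCommGroup A] [NormedSpace ℂ A]
  {G : Type*} [Group G] [TopologicalSpace G] [ChartedSpace A G] [LieGroup 𝓘(ℂ, A) ω G]
  {B : Type*} [NormedAddCommGroup B] [NormedSpace ℂ B]
  {X : Type*} [TopologicalSpace X] [ChartedSpace B X] [IsManifold 𝓘(ℂ, B) ω X]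
  [MulAction (Torus n) X]
  {C : Type*} [NormedAddCommGroup C] [NormedSpace ℂ C]
  {E : Type*} [TopologicalSpace E] [ChartedSpace C E] [IsManifold 𝓘(ℂ, C) ω E]
  [MulAction (Torus n) E] [MulAction Gᵐᵒᵖ E]

variable (n A G B C) in
/-- `π : E → X` is a holomorphic `T`-equivariant principal `G`-bundle, where `T = (ℂ^*)^n`, `G` is a
complex Lie group (modelled on `A`) and `X`, `E` are complex manifolds (modelled on `B`, `C`). The
group `T` acts on `X` and on `E` from the left, and `G` acts on `E` from the right; the right action
`e · g` is written `MulOpposite.op g • e`. -/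
structure IsHolomorphicEquivariantPrincipalBundle (π : E → X) : Prop where
  holomorphic_proj : ContMDiff 𝓘(ℂ, C) 𝓘(ℂ, B) ω π
  holomorphic_torus_action : ContMDiff (𝓘(ℂ, Fin n → ℂ).prod 𝓘(ℂ, C)) 𝓘(ℂ, C) ω
    (fun p : Torus n × E => p.1 • p.2)
  holomorphic_right_action : ContMDiff (𝓘(ℂ, C).prod 𝓘(ℂ, A)) 𝓘(ℂ, C) ω
    (fun p : E × G => MulOpposite.op p.2 • p.1)
  proj_right_action : ∀ (e : E) (g : G), π (MulOpposite.op g • e) = π e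
  proj_torus_action : ∀ (t : Torus n) (e : E), π (t • e) = t • π e
  actions_commute : ∀ (t : Torus n) (e : E) (g : G),
    t • (MulOpposite.op g • e) = MulOpposite.op g • (t • e)
  /-- Around every point of `X` there is a biholomorphic trivialization `π⁻¹(U) ≅ U × G` over `U`
  which is equivariant for the right action of `G`. -/
  locally_trivial : ∀ x : X, ∃ φ : Bundle.Trivialization G π, x ∈ φ.baseSet ∧
    ContMDiffOn 𝓘(ℂ, C) (𝓘(ℂ, B).prod 𝓘(ℂ, A)) ω φ φ.source ∧
    ContMDiffOn (𝓘(ℂ, B).prod 𝓘(ℂ, A)) 𝓘(ℂ, C) ω φ.toOpenPartialHomeomorph.symm φ.target ∧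
    ∀ e ∈ φ.source, ∀ g : G, (φ (MulOpposite.op g • e)).2 = (φ e).2 * g

/-- A biholomorphic map `Φ : E ≅ X × G` is a (global) trivialization of the principal `G`-bundle
`π : E → X` if it is a map over `X` and is equivariant for the right actions of `G`, the one on
`X × G` being `(x, h) · g = (x, h g)`. -/
def IsPrincipalTrivialization (π : E → X)
    (Φ : Diffeomorph 𝓘(ℂ, C) (𝓘(ℂ, B).prod 𝓘(ℂ, A)) E (X × G) ω) : Prop :=
  (∀ e, (Φ e).1 = π e) ∧ ∀ (e : E) (g : G), (Φ (MulOpposite.op g • e)).2 = (Φ e).2 * g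

variable (n) in
/-- In the trivialization `Φ` the torus acts trivially on the fibre `G`, that is, its action on
`X × G` is `t (x, h) = (t x, h)`. -/
def TorusActsTrivially (Φ : Diffeomorph 𝓘(ℂ, C) (𝓘(ℂ, B).prod 𝓘(ℂ, A)) E (X × G) ω) : Prop :=
  ∀ (t : Torus n) (e : E), Φ (t • e) = (t • (Φ e).1, (Φ e).2)

end Bundles

end

/-!
Over the open orbit `T x₀` the bundle has the `T`-invariant section `t x₀ ↦ t e₀`, and hence a
continuous `G`-equivariant map to the discrete group `G`. The boundary of the open orbit does not
locally disconnect `X`, so this locally constant map extends to all of `E`, where it stays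
equivariant by density; an equivariant map to the structure group trivializes the bundle. As `T` is
connected, it cannot move the points of the discrete fibre of any trivialization.
-/

open Filter Topology

section ConnectedTraces

variable {X Y Z : Type*} [TopologicalSpace X] [TopologicalSpace Y] [TopologicalSpace Z]

/-- `A` has arbitrarily small neighbourhoods of `x` with connected, in particular nonempty, traces
on it: the complement of `A` does not locally disconnect the space at `x`. -/
def HasConnectedTracesAt (A : Set X) (x : X) : Prop :=
  ∀ s ∈ 𝓝 x, ∃ u ∈ 𝓝 x, u ⊆ s ∧ IsConnected (u ∩ A)

theorem dense_of_hasConnectedTracesAt {A : Set X} (hA : ∀ x, HasConnectedTracesAt A x) :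
    Dense A := fun x => mem_closure_iff_nhds.2 fun s hs =>
  let ⟨_, _, hus, huA⟩ := hA x s hs
  huA.nonempty.mono (Set.inter_subset_inter_left A hus)

namespace HasConnectedTracesAt

theorem of_openPartialHomeomorph {A : Set X} {B : Set Y} {x : X} (e : OpenPartialHomeomorph X Y)
    (hAB : e.IsImage A B) (hx : x ∈ e.source) (hB : HasConnectedTracesAt B (e x)) :
    HasConnectedTracesAt A x := by
  intro s hs
  have hs' : e.symm ⁻¹' s ∩ e.target ∈ 𝓝 (e x) :=
    inter_mem (e.continuousAt_symm (e.map_source hx) (by rwa [e.left_inv hx]))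
      (e.open_target.mem_nhds (e.map_source hx))
  obtain ⟨u, hu, hus, huB⟩ := hB _ hs'
  have hut : u ⊆ e.target := fun _ hy => (hus hy).2
  refine ⟨e.symm '' u, ?_, Set.image_subset_iff.2 fun _ hy => (hus hy).1, ?_⟩
  · simpa only [e.left_inv hx] using e.symm.image_mem_nhds (e.map_source hx) hu
  · have htrace : e.symm '' u ∩ A = e.symm '' (u ∩ B) := by
      rw [← Set.image_inter_preimage]
      congr 1
      ext y
      exact and_congr_right fun hy => hAB.symm_apply_mem_iff (hut hy)
    rw [htrace]
    exact huB.image _ (e.continuousOn_symm.mono (Set.inter_subset_left.trans hut))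

theorem preimage {A : Set Y} {x : X} {f : X → Y} (hf : IsLocalHomeomorph f)
    (hA : HasConnectedTracesAt A (f x)) : HasConnectedTracesAt (f ⁻¹' A) x := by
  obtain ⟨e, hx, rfl⟩ := hf x
  exact of_openPartialHomeomorph e (fun _ _ => Iff.rfl) hx hA

theorem pi {ι : Type*} [Finite ι] {X : ι → Type*} [∀ i, TopologicalSpace (X i)]
    {A : ∀ i, Set (X i)} {x : ∀ i, X i} (hA : ∀ i, HasConnectedTracesAt (A i) (x i)) :
    HasConnectedTracesAt (Set.univ.pi A) x := by
  intro s hs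
  rw [nhds_pi, Filter.mem_pi'] at hs
  obtain ⟨I, t, ht, hts⟩ := hs
  choose u hu hut huA using fun i => hA i (t i) (ht i)
  refine ⟨Set.univ.pi u, set_pi_mem_nhds Set.finite_univ fun i _ => hu i,
    (Set.pi_mono' (fun i _ => hut i) (Set.subset_univ _)).trans hts, ?_⟩
  rw [← Set.pi_inter_distrib]
  exact isConnected_univ_pi.2 huA

theorem compl_of_countable {V : Type*} [NormedAddCommGroup V] [NormedSpace ℝ V]
    (hV : 1 < Module.rank ℝ V) {s : Set V} (hs : s.Countable) (x : V) :
    HasConnectedTracesAt sᶜ x := by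
  intro t ht
  obtain ⟨r, hr, hrt⟩ := Metric.mem_nhds_iff.1 ht
  let e := OpenPartialHomeomorph.univBall x r
  have hinj : Function.Injective e := by
    simpa [e, Set.injOn_univ] using e.injOn
  have hball : Set.range e = Metric.ball x r := by
    rw [← Set.image_univ, ← OpenPartialHomeomorph.univBall_source x r, e.image_source_eq_target,
      OpenPartialHomeomorph.univBall_target x hr]
  refine ⟨Metric.ball x r, Metric.ball_mem_nhds x hr, hrt, ?_⟩
  rw [← hball, Set.inter_comm, ← Set.image_preimage_eq_inter_range]
  exact ((hs.preimage hinj).isConnected_compl_of_one_lt_rank hV).image e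
    (OpenPartialHomeomorph.continuous_univBall x r).continuousOn

end HasConnectedTracesAt

theorem exists_continuous_eqOn_of_hasConnectedTracesAt [DiscreteTopology Z] {A : Set X}
    (hA : ∀ x, HasConnectedTracesAt A x) {f : X → Z} (hf : ContinuousOn f A) :
    ∃ g : X → Z, Continuous g ∧ Set.EqOn g f A := by
  have hlim (x : X) : ∃ z, Tendsto f (𝓝[A] x) (𝓝 z) := by
    obtain ⟨u, hu, -, ⟨y, hy⟩, huA⟩ := hA x Set.univ univ_mem
    have hconst : f =ᶠ[𝓝[A] x] fun _ => f y := by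
      filter_upwards [self_mem_nhdsWithin, mem_nhdsWithin_of_mem_nhds hu] with z hzA hzu
      exact huA.constant (hf.mono Set.inter_subset_right) ⟨hzu, hzA⟩ hy
    exact ⟨f y, tendsto_const_nhds.congr' hconst.symm⟩
  exact ⟨extendFrom A f, continuous_extendFrom (dense_of_hasConnectedTracesAt hA) hlim,
    extendFrom_extends hf⟩

end ConnectedTraces

theorem contMDiffAt_of_continuousAt_of_discreteTopology {𝕜 : Type*} [NontriviallyNormedField 𝕜]
    {V : Type*} [NormedAddCommGroup V] [NormedSpace 𝕜 V] {H : Type*} [TopologicalSpace H]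
    {I : ModelWithCorners 𝕜 V H} {M : Type*} [TopologicalSpace M] [ChartedSpace H M]
    {W : Type*} [NormedAddCommGroup W] [NormedSpace 𝕜 W] {K : Type*} [TopologicalSpace K]
    {J : ModelWithCorners 𝕜 W K} {N : Type*} [TopologicalSpace N] [ChartedSpace K N]
    [DiscreteTopology N] {k : WithTop ℕ∞} {f : M → N} {x : M} (hf : ContinuousAt f x) :
    ContMDiffAt I J k f x :=
  contMDiffAt_const.congr_of_eventuallyEq (hf ((isOpen_discrete {f x}).mem_nhds rfl))

namespace Torus

variable {n : ℕ}

instance : IsTopologicalGroup (Torus n) := inferInstanceAs (IsTopologicalGroup (Fin n → ℂˣ))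

instance : PreconnectedSpace (Torus n) := inferInstanceAs (PreconnectedSpace (Fin n → ℂˣ))

end Torus

namespace IsHolomorphicEquivariantPrincipalBundle

variable {n : ℕ}
  {A : Type*} [NormedAddCommGroup A] [NormedSpace ℂ A]
  {G : Type*} [Group G] [TopologicalSpace G] [ChartedSpace A G]
  {B : Type*} [NormedAddCommGroup B] [NormedSpace ℂ B]
  {X : Type*} [TopologicalSpace X] [ChartedSpace B X] [MulAction (Torus n) X]
  {C : Type*} [NormedAddCommGroup C] [NormedSpace ℂ C]
  {E : Type*} [TopologicalSpace E] [ChartedSpace C E] [MulAction (Torus n) E] [MulAction Gᵐᵒᵖ E]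
  {π : E → X}

theorem exists_op_smul_eq (hπ : IsHolomorphicEquivariantPrincipalBundle n A G B C π) {e e' : E}
    (h : π e = π e') : ∃ g : G, MulOpposite.op g • e = e' := by
  obtain ⟨φ, hx, -, -, hφ⟩ := hπ.locally_trivial (π e)
  have he : e ∈ φ.source := φ.mem_source.2 hx
  have he' : e' ∈ φ.source := φ.mem_source.2 (h ▸ hx)
  set g := (φ e).2⁻¹ * (φ e').2
  have hge : MulOpposite.op g • e ∈ φ.source := by rwa [φ.mem_source, hπ.proj_right_action]
  refine ⟨g, φ.injOn hge he' (Prod.ext ?_ ?_)⟩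
  · exact (φ.coe_fst hge).trans
      ((hπ.proj_right_action e g).trans (h.trans (φ.coe_fst he').symm))
  · exact (hφ e he g).trans (mul_inv_cancel_left _ _)

theorem exists_local_section (hπ : IsHolomorphicEquivariantPrincipalBundle n A G B C π) (x : X) :
    ∃ U ∈ 𝓝 x, ∃ s : X → E, ContMDiffOn 𝓘(ℂ, B) 𝓘(ℂ, C) ω s U ∧ ∀ y ∈ U, π (s y) = y := by
  obtain ⟨φ, hx, -, hφ, -⟩ := hπ.locally_trivial x
  refine ⟨φ.baseSet, φ.open_baseSet.mem_nhds hx,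
    fun y => φ.toOpenPartialHomeomorph.symm (y, 1), ?_, fun y hy => φ.proj_symm_apply' hy⟩
  exact hφ.comp (contMDiff_id.prodMk contMDiff_const).contMDiffOn fun y hy => φ.mem_target.2 hy

theorem bijective_proj_prodMk (hπ : IsHolomorphicEquivariantPrincipalBundle n A G B C π)
    (f : E →[Gᵐᵒᵖ] G) : Function.Bijective fun e => (π e, f e) := by
  have hf (g : G) (e : E) : f (MulOpposite.op g • e) = f e * g := map_smul f _ e
  constructor
  · intro e e' h
    obtain ⟨hπe, hfe⟩ := Prod.mk.inj h
    obtain ⟨g, rfl⟩ := hπ.exists_op_smul_eq hπe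
    have hg : g = 1 := by rwa [hf, left_eq_mul] at hfe
    rw [hg, MulOpposite.op_one, one_smul]
  · rintro ⟨x, g⟩
    obtain ⟨U, hU, s, -, hs⟩ := hπ.exists_local_section x
    refine ⟨MulOpposite.op ((f (s x))⁻¹ * g) • s x, Prod.ext ?_ ?_⟩
    · exact (hπ.proj_right_action _ _).trans (hs x (mem_of_mem_nhds hU))
    · exact (hf _ _).trans (mul_inv_cancel_left _ _)

theorem exists_isPrincipalTrivialization [LieGroup 𝓘(ℂ, A) ω G]
    (hπ : IsHolomorphicEquivariantPrincipalBundle n A G B C π)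
    (f : E →[Gᵐᵒᵖ] G) (hf : ContMDiff 𝓘(ℂ, C) 𝓘(ℂ, A) ω f) :
    ∃ Φ : Diffeomorph 𝓘(ℂ, C) (𝓘(ℂ, B).prod 𝓘(ℂ, A)) E (X × G) ω,
      IsPrincipalTrivialization π Φ := by
  let Φ : E ≃ X × G := Equiv.ofBijective _ (hπ.bijective_proj_prodMk f)
  refine ⟨⟨Φ, hπ.holomorphic_proj.prodMk hf, fun ⟨x, h⟩ => ?_⟩, fun _ => rfl,
    fun e g => map_smul f (MulOpposite.op g) e⟩
  obtain ⟨U, hU, s, hsU, hs⟩ := hπ.exists_local_section x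
  have hsx : ContMDiffAt (𝓘(ℂ, B).prod 𝓘(ℂ, A)) 𝓘(ℂ, C) ω (fun q : X × G => s q.1) (x, h) :=
    (hsU.contMDiffAt hU).comp (x, h) contMDiffAt_fst
  have hinv : ContMDiffAt (𝓘(ℂ, B).prod 𝓘(ℂ, A)) 𝓘(ℂ, C) ω
      (fun q : X × G => MulOpposite.op ((f (s q.1))⁻¹ * q.2) • s q.1) (x, h) :=
    (hπ.holomorphic_right_action _).comp (x, h)
      (hsx.prodMk (((hf _).comp (x, h) hsx).inv.mul contMDiffAt_snd))
  refine hinv.congr_of_eventuallyEq ?_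
  filter_upwards [continuousAt_fst hU] with q hq
  refine Φ.symm_apply_eq.2 (Prod.ext ?_ ?_)
  · exact ((hπ.proj_right_action _ _).trans (hs q.1 hq)).symm
  · exact ((map_smul f _ (s q.1)).trans (mul_inv_cancel_left _ _)).symm

theorem exists_continuousOn_equivariant (hπ : IsHolomorphicEquivariantPrincipalBundle n A G B C π)
    {x₀ : X} {D : Set X} {a : X → Torus n} (ha : ContinuousOn a D)
    (hax : ∀ x ∈ D, a x • x₀ = x) :
    ∃ f : E → G, ContinuousOn f (π ⁻¹' D) ∧
      ∀ e ∈ π ⁻¹' D, ∀ g : G, f (MulOpposite.op g • e) = f e * g := by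
  obtain ⟨φ, hx₀, -, -, hφ⟩ := hπ.locally_trivial x₀
  have hsource : Set.MapsTo (fun e => (a (π e))⁻¹ • e) (π ⁻¹' D) φ.source := fun e he => by
    rwa [φ.mem_source, hπ.proj_torus_action, inv_smul_eq_iff.2 (hax _ he).symm]
  refine ⟨fun e => (φ ((a (π e))⁻¹ • e)).2, ?_, fun e he g => ?_⟩
  · have htransport : ContinuousOn (fun e => (a (π e))⁻¹ • e) (π ⁻¹' D) :=
      hπ.holomorphic_torus_action.continuous.comp_continuousOn
        ((ha.comp hπ.holomorphic_proj.continuous.continuousOn fun _ he => he).inv.prodMk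
          continuousOn_id)
    have hφ_cont : ContinuousOn φ φ.source := φ.toOpenPartialHomeomorph.continuousOn
    exact continuous_snd.comp_continuousOn (hφ_cont.comp htransport hsource)
  · simp only [hπ.proj_right_action, hπ.actions_commute]
    exact hφ _ (hsource he) g

section DiscreteStructureGroup

variable [DiscreteTopology G]

theorem isLocalHomeomorph_proj (hπ : IsHolomorphicEquivariantPrincipalBundle n A G B C π) :
    IsLocalHomeomorph π := by
  choose φ hφ _ using hπ.locally_trivial
  exact (IsCoveringMap.mk π (fun _ => G) φ hφ).isLocalHomeomorph

theorem exists_continuous_equivariant (hπ : IsHolomorphicEquivariantPrincipalBundle n A G B C π)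
    {D : Set X} (hD : ∀ x, HasConnectedTracesAt D x) {f₀ : E → G} (hf₀ : ContinuousOn f₀ (π ⁻¹' D))
    (hf₀G : ∀ e ∈ π ⁻¹' D, ∀ g : G, f₀ (MulOpposite.op g • e) = f₀ e * g) :
    ∃ f : E →[Gᵐᵒᵖ] G, Continuous f := by
  have hE (e : E) : HasConnectedTracesAt (π ⁻¹' D) e := .preimage hπ.isLocalHomeomorph_proj (hD _)
  obtain ⟨f, hf, hff₀⟩ := exists_continuous_eqOn_of_hasConnectedTracesAt hE hf₀
  have hact (g : G) : Continuous fun e : E => MulOpposite.op g • e :=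
    hπ.holomorphic_right_action.continuous.comp (Continuous.prodMk_left g)
  refine ⟨⟨f, fun g => congrFun (Continuous.ext_on (dense_of_hasConnectedTracesAt hE)
    (hf.comp (hact g.unop)) (continuous_of_discreteTopology.comp hf) fun e he => ?_)⟩, hf⟩
  have hge : MulOpposite.op g.unop • e ∈ π ⁻¹' D := by
    rwa [Set.mem_preimage, hπ.proj_right_action]
  calc f (MulOpposite.op g.unop • e) = f₀ (MulOpposite.op g.unop • e) := hff₀ hge
    _ = f₀ e * g.unop := hf₀G e he g.unop
    _ = g • f e := by rw [hff₀ he]; rfl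

theorem torusActsTrivially (hπ : IsHolomorphicEquivariantPrincipalBundle n A G B C π)
    {Φ : Diffeomorph 𝓘(ℂ, C) (𝓘(ℂ, B).prod 𝓘(ℂ, A)) E (X × G) ω}
    (hΦ : IsPrincipalTrivialization π Φ) : TorusActsTrivially n Φ := by
  intro t e
  have horbit : Continuous fun t : Torus n => (Φ (t • e)).2 :=
    continuous_snd.comp (Φ.continuous.comp
      (hπ.holomorphic_torus_action.continuous.comp (Continuous.prodMk_left e)))
  refine Prod.ext ?_ ?_
  · rw [hΦ.1, hΦ.1, hπ.proj_torus_action]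
  · simpa only [one_smul] using PreconnectedSpace.constant inferInstance horbit (x := t) (y := 1)

end DiscreteStructureGroup

end IsHolomorphicEquivariantPrincipalBundle

theorem theorem4p2_general {n : ℕ}
    {G : Type*} [Group G] [TopologicalSpace G] [DiscreteTopology G]
    {B : Type*} [NormedAddCommGroup B] [NormedSpace ℂ B]
    {X : Type*} [TopologicalSpace X] [ChartedSpace B X] [MulAction (Torus n) X]
    {C : Type*} [NormedAddCommGroup C] [NormedSpace ℂ C]
    {E : Type*} [TopologicalSpace E] [ChartedSpace C E] [MulAction (Torus n) E] [MulAction Gᵐᵒᵖ E]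
    {x₀ : X} {D : Set X} (hD : ∀ x, HasConnectedTracesAt D x)
    {a : X → Torus n} (ha : ContinuousOn a D) (hax : ∀ x ∈ D, a x • x₀ = x)
    (π : E → X) (hπ : IsHolomorphicEquivariantPrincipalBundle n (Fin 0 → ℂ) G B C π) :
    (∃ Φ : Diffeomorph 𝓘(ℂ, C) (𝓘(ℂ, B).prod 𝓘(ℂ, Fin 0 → ℂ)) E (X × G) ω,
      IsPrincipalTrivialization π Φ) ∧
    ∀ Φ : Diffeomorph 𝓘(ℂ, C) (𝓘(ℂ, B).prod 𝓘(ℂ, Fin 0 → ℂ)) E (X × G) ω,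
      IsPrincipalTrivialization π Φ → TorusActsTrivially n Φ := by
  obtain ⟨f₀, hf₀, hf₀G⟩ := hπ.exists_continuousOn_equivariant ha hax
  obtain ⟨f, hf⟩ := hπ.exists_continuous_equivariant hD hf₀ hf₀G
  have hf_holo : ContMDiff 𝓘(ℂ, C) 𝓘(ℂ, Fin 0 → ℂ) ω f := fun _ =>
    contMDiffAt_of_continuousAt_of_discreteTopology hf.continuousAt
  exact ⟨hπ.exists_isPrincipalTrivialization f hf_holo, fun _ => hπ.torusActsTrivially⟩

section LatticeCones

variable {n : ℕ} (b : Module.Basis (Fin n) ℤ (Fin n → ℤ))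

theorem dualVec_basisFun (i : Fin n) : dualVec (Pi.basisFun ℤ (Fin n)) i = Pi.single i 1 := by
  ext k
  simp only [dualVec, Pi.basisFun_repr, Pi.single_apply, eq_comm]

theorem basisCone_empty : basisCone b ∅ = ⊥ := by
  simp only [basisCone, Set.image_empty, PointedCone.hull, Submodule.span_empty]

theorem perpTo_bot (m : Fin n → ℤ) : PerpTo ⊥ m := by
  rintro v (rfl : v = 0)
  simp only [latticePairing, Pi.zero_apply, mul_zero, Finset.sum_const_zero]

theorem eq_bot_iff_forall_perpTo_dualVec {τ : PointedCone ℝ (Fin n → ℝ)} :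
    τ = ⊥ ↔ ∀ i, PerpTo τ (dualVec b i) := by
  refine ⟨fun h i => h ▸ perpTo_bot _, fun h => (Submodule.eq_bot_iff τ).2 fun v hv => ?_⟩
  rw [eq_sum_latticeVec b v]
  exact Finset.sum_eq_zero fun i _ => by rw [h i v hv, zero_smul]

theorem NonsingularFan.bot_mem (Ξ : NonsingularFan n) : ⊥ ∈ Ξ.cones := by
  obtain ⟨σ, hσ⟩ := Ξ.nonempty
  obtain ⟨b, J, rfl⟩ := Ξ.nonsingular σ hσ
  rw [← basisCone_empty b]
  exact Ξ.face_mem _ hσ _ (basisCone_isFaceOf b J.empty_subset)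

end LatticeCones

namespace ToricVariety

variable {n : ℕ} {Ξ : NonsingularFan n}

/-- The open orbit of the torus, namely the orbit `O_τ` of the cone `τ = 0`. -/
def openOrbit (Ξ : NonsingularFan n) : Set (ToricVariety Ξ) := {x | x.cone = ⊥}

theorem mem_openOrbit_iff (b : Module.Basis (Fin n) ℤ (Fin n → ℤ)) {x : ToricVariety Ξ} :
    x ∈ openOrbit Ξ ↔ ∀ i, x.val (dualVec b i) ≠ 0 := by
  simp only [x.val_ne_zero_iff]
  exact eq_bot_iff_forall_perpTo_dualVec b

/-- The affine chart `affineChart b J hσ` as an open partial homeomorphism. -/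
noncomputable def affineHomeomorph {b : Module.Basis (Fin n) ℤ (Fin n → ℤ)} {J : Set (Fin n)}
    (hσ : basisCone b J ∈ Ξ.cones) : OpenPartialHomeomorph (ToricVariety Ξ) (Fin n → ℂ) :=
  (chartCore Ξ).openPartialHomeomorph (affineChart b J hσ) ⟨b, J, hσ, rfl⟩

theorem hasConnectedTracesAt_openOrbit (x : ToricVariety Ξ) :
    HasConnectedTracesAt (openOrbit Ξ) x := by
  obtain ⟨b, J, hx⟩ := Ξ.nonsingular _ x.cone_mem
  have hσ : basisCone b J ∈ Ξ.cones := hx ▸ x.cone_mem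
  have himage : (affineHomeomorph hσ).IsImage (openOrbit Ξ) (Set.univ.pi fun _ => {0}ᶜ) :=
    fun y _ => Set.mem_univ_pi.trans (mem_openOrbit_iff b).symm
  have hsource : x ∈ (affineHomeomorph hσ).source := by
    change x.cone.IsFaceOf (basisCone b J)
    rw [← hx]
  have hrank : 1 < Module.rank ℝ ℂ := by simp
  exact .of_openPartialHomeomorph _ himage hsource
    (.pi fun _ => .compl_of_countable hrank (Set.countable_singleton 0) _)

variable (Ξ) in
/-- The unit of the torus as a point of the open orbit: the character group `M` is sent to `1`. -/
def basePoint : ToricVariety Ξ where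
  cone := ⊥
  cone_mem := Ξ.bot_mem
  val _ := 1
  val_ne_zero_iff m := iff_of_true one_ne_zero (perpTo_bot m)
  val_zero := rfl
  val_add _ _ _ _ := (one_mul 1).symm

/-- The coordinates of a point of the open orbit as an element of the torus. Outside the open orbit
a vanishing coordinate is replaced by `1`. -/
noncomputable def toTorus (x : ToricVariety Ξ) : Torus n := fun i =>
  open Classical in if h : x.val (Pi.single i 1) ≠ 0 then Units.mk0 _ h else 1

theorem coe_toTorus_apply {x : ToricVariety Ξ} (hx : x ∈ openOrbit Ξ) (i : Fin n) :
    (toTorus x i : ℂ) = x.val (Pi.single i 1) := by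
  have hi : x.val (Pi.single i 1) ≠ 0 := dualVec_basisFun i ▸ (mem_openOrbit_iff _).1 hx i
  rw [toTorus, dif_pos hi, Units.val_mk0]

theorem val_eq_character_toTorus {x : ToricVariety Ξ} (hx : x ∈ openOrbit Ξ) (m : Fin n → ℤ) :
    x.val m = Torus.character m (toTorus x) := by
  have hperp (m : Fin n → ℤ) : PerpTo x.cone m := by
    rw [show x.cone = ⊥ from hx]
    exact perpTo_bot m
  calc x.val m = x.val (∑ i, m i • Pi.single i 1) := by
        congr 1
        simpa using pi_eq_sum_univ' m
    _ = ∏ i, x.val (m i • Pi.single i 1) := (x.val_sum _ _ fun _ _ => hperp _).2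
    _ = Torus.character m (toTorus x) := Finset.prod_congr rfl fun i _ => by
        rw [x.val_zsmul (hperp _), coe_toTorus_apply hx]

theorem toTorus_smul_basePoint {x : ToricVariety Ξ} (hx : x ∈ openOrbit Ξ) :
    toTorus x • basePoint Ξ = x :=
  ToricVariety.ext (show ⊥ = x.cone from hx.symm)
    (funext fun m => (mul_one _).trans (val_eq_character_toTorus hx m).symm)

theorem continuousOn_toTorus : ContinuousOn toTorus (openOrbit Ξ) := by
  let b := Pi.basisFun ℤ (Fin n)
  have hσ : basisCone b ∅ ∈ Ξ.cones := basisCone_empty b ▸ Ξ.bot_mem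
  have hsource : openOrbit Ξ ⊆ (affineHomeomorph hσ).source := fun x hx => by
    change x.cone.IsFaceOf (basisCone b ∅)
    rw [basisCone_empty, show x.cone = ⊥ from hx]
  have hcoords : Set.EqOn (Torus.coords ∘ toTorus) (affineHomeomorph hσ) (openOrbit Ξ) :=
    fun x hx => funext fun i =>
      (coe_toTorus_apply hx i).trans (congrArg x.val (dualVec_basisFun i).symm)
  exact Torus.isOpenEmbedding_coords.isInducing.continuousOn_iff.2
    (((affineHomeomorph hσ).continuousOn.mono hsource).congr hcoords)

end ToricVariety

theorem theorem4p2 {n : ℕ} (Ξ : NonsingularFan n)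
    {G : Type*} [Group G] [TopologicalSpace G] [DiscreteTopology G]
    {C : Type*} [NormedAddCommGroup C] [NormedSpace ℂ C]
    {E : Type*} [TopologicalSpace E] [ChartedSpace C E] [IsManifold 𝓘(ℂ, C) ω E]
    [MulAction (Torus n) E] [MulAction Gᵐᵒᵖ E]
    (π : E → ToricVariety Ξ)
    (hπ : IsHolomorphicEquivariantPrincipalBundle n (Fin 0 → ℂ) G (Fin n → ℂ) C π) :
    (∃ Φ : Diffeomorph 𝓘(ℂ, C) (𝓘(ℂ, Fin n → ℂ).prod 𝓘(ℂ, Fin 0 → ℂ)) E (ToricVariety Ξ × G) ω,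
      IsPrincipalTrivialization π Φ) ∧
    ∀ Φ : Diffeomorph 𝓘(ℂ, C) (𝓘(ℂ, Fin n → ℂ).prod 𝓘(ℂ, Fin 0 → ℂ)) E (ToricVariety Ξ × G) ω,
      IsPrincipalTrivialization π Φ → TorusActsTrivially n Φ :=
  theorem4p2_general ToricVariety.hasConnectedTracesAt_openOrbit
    ToricVariety.continuousOn_toTorus (fun _ => ToricVariety.toTorus_smul_basePoint) π hπ
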